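/- Let $N\ge 1$ be an integer, $0<s\le 1$, and let $S_N=\mathrm{span}_{\mathbb C}\{e^{i\kappa x}:\kappa\in\mathbb Z,\ |\kappa|\le N\}$ be the space of $2\pi$-periodic complex trigonometric polynomials of degree at most $N$. For a $2\pi$-periodic square integrable function $v$ let $\widehat v_\kappa=\frac1{2\pi}\int_{-\pi}^{\pi}v(x)e^{-i\kappa x}\,dx$ and $P_Nv=\sum_{|\kappa|\le N}\widehat v_\kappa e^{i\kappa x}$; for $v\in S_N$ let $(-\partial_{xx})^s v=\sum_{|\kappa|\le N}|\kappa|^{2s}\widehat v_\kappa e^{i\kappa x}$. Define $F:S_N\to S_N$ by $$F(u)=-i(-\partial_{xx})^s u+iP_N(|u|^2u).$$ Let $q$ be a non-negative integer, $b_1,\dots,b_q$ arbitrary real numbers, and $k>0$ an arbitrary step size. Then for every $U^n\in S_N$ the equations of one step of the fully discrete scheme, $$Y^{n,0}=U^n,\qquad Y^{n,j}=Y^{n,j-1}+k\,b_j\,F\!\left(\frac{Y^{n,j}+Y^{n,j-1}}{2}\right)\quad(1\le j\le q),\qquad U^{n+1}=Y^{n,q},$$ admit a solution $Y^{n,j}\in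 S_N$, $1\le j\le q$ (with no restriction on the size of $k$). In particular this holds when $q=3^{p-1}$, $p\ge1$, and the $b_j$ are the nonzero coefficients of the Yoshida compositions of the implicit midpoint rule. -/

import Mathlib

open scoped Real

noncomputable section

namespace FracNLS

/-- `S_N = span {e^{ikx} : k ∈ ℤ, |k| ≤ N}`, the complex trigonometric polynomials of degree at most
`N`, as continuous functions on the circle `ℝ / 2πℤ` (that is, as `2π`-periodic functions).
Here `fourier k` is the function `x ↦ e^{ikx}`. -/
def trigPoly (N : ℕ) : Submodule ℂ C(AddCircle (2 * π), ℂ) :=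
  Submodule.span ℂ
    ((fun k : ℤ => (fourier k : C(AddCircle (2 * π), ℂ))) '' Set.Icc (-(N : ℤ)) (N : ℤ))

theorem sum_fourier_mem (N : ℕ) (c : ℤ → ℂ) :
    ∑ k ∈ Finset.Icc (-(N : ℤ)) (N : ℤ), c k • (fourier k : C(AddCircle (2 * π), ℂ))
      ∈ trigPoly N :=
  Submodule.sum_mem _ fun k hk => Submodule.smul_mem _ _
    (Submodule.subset_span ⟨k, Finset.mem_Icc.mp hk, rfl⟩)

/-- The Fourier coefficient `(1 / 2π) ∫_{-π}^{π} v(x) e^{-ikx} dx`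
(`fourierCoeff` integrates against the normalized Haar measure of the circle). -/
def coeff (v : AddCircle (2 * π) → ℂ) (k : ℤ) : ℂ :=
  haveI : Fact (0 < 2 * π) := ⟨Real.two_pi_pos⟩
  fourierCoeff v k

theorem coeff_eq_integral (v : AddCircle (2 * π) → ℂ) (k : ℤ) :
    coeff v k = (1 / (2 * π) : ℂ) *
      ∫ x in (-π)..π, v (x : AddCircle (2 * π)) * Complex.exp (-(Complex.I * k * x)) := by
  have : Fact (0 < 2 * π) := ⟨Real.two_pi_pos⟩
  rw [coeff, fourierCoeff_eq_intervalIntegral v k (-π)]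
  have h : -π + 2 * π = π := by ring
  rw [h, Complex.real_smul]
  congr 1
  · push_cast
    rfl
  · refine intervalIntegral.integral_congr fun x _ => ?_
    simp only [fourier_coe_apply, smul_eq_mul]
    rw [mul_comm]
    congr 2
    have hpi : (π : ℂ) ≠ 0 := by exact_mod_cast Real.pi_ne_zero
    push_cast
    field_simp

/-- The projection `P_N v = ∑_{|k| ≤ N} v̂_k e^{ikx}` onto `S_N`; it is the orthogonal projection on
square integrable `v`, and is applied below to continuous `v` only. -/
def proj (N : ℕ) (v : AddCircle (2 * π) → ℂ) : trigPoly N :=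
  ⟨∑ k ∈ Finset.Icc (-(N : ℤ)) (N : ℤ), coeff v k • fourier k, sum_fourier_mem N _⟩

/-- The fractional operator `(-∂_xx)^s` on `S_N`: it multiplies the `k`-th Fourier coefficient by
`|k|^{2s}`. -/
def fracLap (N : ℕ) (s : ℝ) (v : trigPoly N) : trigPoly N :=
  ⟨∑ k ∈ Finset.Icc (-(N : ℤ)) (N : ℤ),
    (((|(k : ℝ)| ^ (2 * s) : ℝ) : ℂ) * coeff v.1 k) • fourier k, sum_fourier_mem N _⟩

/-- The cubic nonlinearity `f(u) = |u|² u`. -/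
def cubic (z : ℂ) : ℂ := ((‖z‖ ^ 2 : ℝ) : ℂ) * z

/-- The semidiscrete vector field `F(u) = -i (-∂_xx)^s u + i P_N f(u)` on `S_N`. -/
def vecField (N : ℕ) (s : ℝ) (u : trigPoly N) : trigPoly N :=
  -(Complex.I • fracLap N s u) + Complex.I • proj N (fun x => cubic (u.1 x))

/-- One step of size `k` of the fully discrete scheme with coefficients `b₁, …, b_q` (the
composition of `q` implicit midpoint rules): from `U` it produces the stages `Y 0, …, Y q` and the
next approximation `Unext`. The stage `Y j.succ` uses the coefficient `b j`. -/
structure IsSchemeStep (N : ℕ) (s k : ℝ) {q : ℕ} (b : Fin q → ℝ) (U : trigPoly N)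
    (Y : Fin (q + 1) → trigPoly N) (Unext : trigPoly N) : Prop where
  init : Y 0 = U
  stage : ∀ j : Fin q, Y j.succ = Y j.castSucc +
    ((k * b j : ℝ) : ℂ) • vecField N s ((1 / 2 : ℂ) • (Y j.succ + Y j.castSucc))
  next : Unext = Y (Fin.last q)

end FracNLS

end

/-!
Solvability of the composed implicit midpoint rule, for every step size.

With the midpoint `Z = (V + U) / 2` as unknown, one stage reads `Z = U + τ F(Z)` where `τ = k b_j / 2`
is real. Both terms of `F` conserve mass: `Re ⟨F(Z), Z⟩ = 0`, because `⟨(-∂_xx)^s Z, Z⟩` and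
`⟨P_N(|Z|² Z), Z⟩ = ∫ |Z|⁴` are real (`im_sum_star_mul_coeff_cubic` is the second fact). Hence every
solution satisfies `‖Z‖ ≤ ‖U‖`, whatever `τ` is, and existence is a fixed point theorem of Brouwer type
(`exists_eq_add_of_inner_self_nonpos`): after multiplying the field by a cutoff it is enough to know
that `id + v` is onto for every `C¹` field `v` with compact support.

This last fact (`surjective_id_add_of_hasCompactSupport`) is proved by change of variables, in the
spirit of the Milnor-Rogers proof of Brouwer's theorem. For a polynomial `h` and a ball `B` that
contains the support of `v`, the integral `∫_B h(x + t v(x)) det(1 + t Dv(x)) dx` is a polynomial in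
`t`. For small `t` the map `id + t v` is a bijection of `B` with positive Jacobian, so the integral
is `∫_B h`; being constant for small `t`, the polynomial has this value at `t = 1` too. If `id + v`
omitted `u`, this would fail for `h(y) = (M - ‖y - u‖²)^m` as `m → ∞`: the values of `h` near `u` are
exponentially larger than those on the image of `B`.
-/

/-! ### Polynomials in the homotopy parameter -/

open Polynomial MeasureTheory Metric Set in
/-- Extrapolation to `1` from arbitrarily small nodes, by Lagrange interpolation. It lets a pointwise
polynomial dependence on `t` pass through an integral without integrating the coefficients. -/
theorem Polynomial.exists_eval_one_eq_sum_small_nodes (d : ℕ) {ε : ℝ} (hε : 0 < ε) :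
    ∃ (S : Finset ℝ) (w : ℝ → ℝ), (∀ t ∈ S, |t| ≤ ε) ∧
      ∀ p : ℝ[X], p.natDegree ≤ d → p.eval 1 = ∑ t ∈ S, w t * p.eval t := by
  obtain ⟨S, hS, hcard⟩ := (Icc_infinite hε).exists_subset_card_eq (d + 1)
  refine ⟨S, fun t => (Lagrange.basis S id t).eval 1, fun t ht => ?_, fun p hp => ?_⟩
  · obtain ⟨h0, h1⟩ := hS ht
    rwa [abs_of_nonneg h0]
  · have hdeg : p.degree < S.card := by
      rw [hcard]
      exact lt_of_le_of_lt p.degree_le_natDegree (by exact_mod_cast Nat.lt_succ_of_le hp)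
    conv_lhs => rw [Lagrange.eq_interpolate (v := id) (injOn_id _) hdeg]
    rw [Lagrange.interpolate_apply, eval_finsetSum]
    exact Finset.sum_congr rfl fun t _ => by simp [mul_comm]

open Polynomial in
theorem ContinuousLinearMap.exists_polynomial_det_one_add_smul {E : Type*} [NormedAddCommGroup E]
    [NormedSpace ℝ E] [FiniteDimensional ℝ E] (A : E →L[ℝ] E) :
    ∃ p : ℝ[X], p.natDegree ≤ Module.finrank ℝ E ∧
      ∀ t : ℝ, p.eval t = (ContinuousLinearMap.id ℝ E + t • A).det := by
  set b := Module.finBasis ℝ E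
  set M := LinearMap.toMatrix b b (A : E →ₗ[ℝ] E) with hM
  refine ⟨((X : ℝ[X]) • M.map C + (1 : Matrix _ _ ℝ).map C).det, ?_, fun t => ?_⟩
  · simpa using natDegree_det_X_add_C_le M 1
  · rw [← coe_evalRingHom, RingHom.map_det, ContinuousLinearMap.det, ← LinearMap.det_toMatrix b]
    congr 1
    have hmat : LinearMap.toMatrix b b
        ((ContinuousLinearMap.id ℝ E + t • A : E →L[ℝ] E) : E →ₗ[ℝ] E) = 1 + t • M := by
      change LinearMap.toMatrix b b (LinearMap.id + t • (A : E →ₗ[ℝ] E)) = _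
      rw [map_add, map_smul, LinearMap.toMatrix_id, ← hM]
    rw [hmat]
    clear_value M
    ext i j
    rcases eq_or_ne i j with rfl | hij
    · simp
      ring
    · simp [hij]
      ring

/-! ### Surjectivity of compactly supported perturbations of the identity -/

section

variable {E : Type*} [NormedAddCommGroup E]

theorem bijective_id_add_of_lipschitzWith [CompleteSpace E] {K : NNReal} (hK : K < 1) {g : E → E}
    (hg : LipschitzWith K g) : Function.Bijective fun x => x + g x := by
  have hc (y : E) : ContractingWith K fun x => y - g x := by
    refine ⟨hK, LipschitzWith.of_dist_le_mul fun a b => ?_⟩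
    rw [dist_sub_left]
    exact hg.dist_le_mul a b
  refine ⟨fun a b hab => ?_, fun y => ?_⟩
  · refine (hc (a + g a)).fixedPoint_unique' (?_ : _ = _) (?_ : _ = _)
    · simp
    · simp only at hab
      simp [hab]
  · have : Nonempty E := ⟨y⟩
    exact ⟨_, sub_eq_iff_eq_add.1 (hc y).fixedPoint_isFixedPt |>.symm⟩

variable [InnerProductSpace ℝ E] [FiniteDimensional ℝ E]

theorem exists_small_bijective_det_pos {v : E → E} (hv : ContDiff ℝ 1 v)
    (hc : HasCompactSupport v) :
    ∃ ε : ℝ, 0 < ε ∧ ∀ t : ℝ, |t| ≤ ε → (Function.Bijective fun x => x + t • v x) ∧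
      ∀ x, 0 < (ContinuousLinearMap.id ℝ E + t • fderiv ℝ v x).det := by
  have : CompleteSpace E := FiniteDimensional.complete ℝ E
  obtain ⟨K, hK⟩ := ContDiff.lipschitzWith_of_hasCompactSupport hc hv one_ne_zero
  have hdet : ∀ᶠ A : E →L[ℝ] E in nhds (ContinuousLinearMap.id ℝ E), 0 < A.det := by
    refine ContinuousLinearMap.continuous_det.continuousAt.eventually_const_lt ?_
    simp [ContinuousLinearMap.det]
  obtain ⟨δ, hδ, hball⟩ := Metric.eventually_nhds_iff.1 hdet
  refine ⟨min (1 / 2) (δ / 2) / (K + 1), by positivity, fun t ht => ?_⟩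
  have htK : |t| * K < min 1 δ := by
    rw [le_div_iff₀ (by positivity)] at ht
    have h1 : |t| * K ≤ |t| * (K + 1) := by gcongr; simp
    refine (h1.trans ht).trans_lt (min_lt_min ?_ ?_) <;> linarith
  refine ⟨bijective_id_add_of_lipschitzWith (K := ‖t‖₊ * K) ?_ ((lipschitzWith_smul t).comp hK),
    fun x => hball ?_⟩
  · rw [← NNReal.coe_lt_coe]
    simpa using htK.trans_le (min_le_left _ _)
  · rw [dist_eq_norm, add_sub_cancel_left, norm_smul, Real.norm_eq_abs]
    refine lt_of_le_of_lt ?_ (htK.trans_le (min_le_right _ _))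
    gcongr
    exact norm_fderiv_le_of_lipschitz ℝ hK

section ChangeOfVariables

variable [MeasurableSpace E] [BorelSpace E] (μ : MeasureTheory.Measure E) [μ.IsAddHaarMeasure]

open MeasureTheory Metric Set in
/-- The change of variables `y = x + t v(x)`, which maps the ball onto itself because it is a
bijection of `E` that fixes every point outside. -/
theorem setIntegral_closedBall_comp_mul_det {v : E → E} (hv : ContDiff ℝ 1 v) {R : ℝ}
    (hR : ∀ x ∉ closedBall (0 : E) R, v x = 0) {t : ℝ}
    (hbij : Function.Bijective fun x => x + t • v x)
    (hdet : ∀ x, 0 < (ContinuousLinearMap.id ℝ E + t • fderiv ℝ v x).det) (h : E → ℝ) :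
    ∫ x in closedBall (0 : E) R,
        h (x + t • v x) * (ContinuousLinearMap.id ℝ E + t • fderiv ℝ v x).det ∂μ
      = ∫ x in closedBall (0 : E) R, h x ∂μ := by
  have himage : (fun x => x + t • v x) '' closedBall (0 : E) R = closedBall 0 R := by
    have hcompl : (fun x => x + t • v x) '' (closedBall (0 : E) R)ᶜ = (closedBall 0 R)ᶜ := by
      have : EqOn (fun x => x + t • v x) id (closedBall (0 : E) R)ᶜ := fun x hx => by
        simp [hR x hx]
      rw [this.image_eq, image_id]
    rw [image_compl_eq hbij] at hcompl
    exact compl_injective hcompl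
  have key := integral_image_eq_integral_abs_det_fderiv_smul μ
    (measurableSet_closedBall (x := (0 : E)) (ε := R))
    (fun x _ => (((hasFDerivAt_id x).add
      ((hv.differentiable one_ne_zero x).hasFDerivAt.const_smul t)).hasFDerivWithinAt))
    hbij.injective.injOn h
  -- the image in `key` is that of a sum of functions, which unfolds to the one in `himage`
  have key' : ∫ x in (fun x => x + t • v x) '' closedBall (0 : E) R, h x ∂μ = _ := key
  rw [himage] at key'
  rw [key']
  refine integral_congr_ae (Filter.Eventually.of_forall fun x => ?_)
  change _ = |(ContinuousLinearMap.id ℝ E + t • fderiv ℝ v x).det| * h (x + t • v x)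
  simp only [abs_of_pos (hdet x)]
  ring

open MeasureTheory Metric Set Polynomial in
/-- The change of variables `y = x + v(x)` on a ball containing the support of `v`, although `id + v`
need not be injective: both sides are values of the same polynomial in the homotopy parameter. -/
theorem setIntegral_pow_comp_mul_det_eq {v : E → E} (hv : ContDiff ℝ 1 v)
    (hc : HasCompactSupport v) {R : ℝ} (hR : ∀ x ∉ closedBall (0 : E) R, v x = 0)
    (u : E) (M : ℝ) (m : ℕ) :
    ∫ x in closedBall (0 : E) R, (M - ‖x + v x - u‖ ^ 2) ^ m *
        (ContinuousLinearMap.id ℝ E + fderiv ℝ v x).det ∂μ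
      = ∫ x in closedBall (0 : E) R, (M - ‖x - u‖ ^ 2) ^ m ∂μ := by
  obtain ⟨ε, hε, hsmall⟩ := exists_small_bijective_det_pos hv hc
  obtain ⟨S, w, hS, hw⟩ := exists_eval_one_eq_sum_small_nodes (m * 2 + Module.finrank ℝ E) hε
  let f (t : ℝ) (x : E) : ℝ := (M - ‖x + t • v x - u‖ ^ 2) ^ m *
    (ContinuousLinearMap.id ℝ E + t • fderiv ℝ v x).det
  have hpoly (x : E) : ∃ p : ℝ[X], p.natDegree ≤ m * 2 + Module.finrank ℝ E ∧
      ∀ t, p.eval t = f t x := by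
    obtain ⟨p, hp, hpe⟩ := (fderiv ℝ v x).exists_polynomial_det_one_add_smul
    refine ⟨(C (-‖v x‖ ^ 2) * X ^ 2 + C (-(2 * inner ℝ (x - u) (v x))) * X +
      C (M - ‖x - u‖ ^ 2)) ^ m * p, ?_, fun t => ?_⟩
    · exact natDegree_mul_le.trans
        (add_le_add (natDegree_pow_le_of_le m natDegree_quadratic_le) hp)
    · rw [eval_mul, hpe]
      simp only [f, eval_pow, eval_add, eval_mul, eval_C, eval_X]
      congr 2
      rw [show x + t • v x - u = (x - u) + t • v x by abel, norm_add_sq_real, norm_smul,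
        inner_smul_right, mul_pow, Real.norm_eq_abs, sq_abs]
      ring
  have hinterp (x : E) : f 1 x = ∑ t ∈ S, w t * f t x := by
    obtain ⟨p, hp, hpe⟩ := hpoly x
    simpa [hpe] using hw p hp
  have hcont (t : ℝ) : Continuous (f t) := by
    have := hv.continuous
    have := hv.continuous_fderiv one_ne_zero
    have hd := (ContinuousLinearMap.continuous_det (𝕜 := ℝ) (E := E)).comp
      (f := fun x => ContinuousLinearMap.id ℝ E + t • fderiv ℝ v x) (by fun_prop)
    exact Continuous.mul (by fun_prop) hd
  have hint (t : ℝ) : IntegrableOn (f t) (closedBall 0 R) μ :=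
    (hcont t).continuousOn.integrableOn_compact (isCompact_closedBall 0 R)
  have hsum : ∑ t ∈ S, w t = 1 := by simpa using (hw 1 (by simp)).symm
  have hone : ∫ x in closedBall 0 R, f 1 x ∂μ =
      ∫ x in closedBall 0 R, ∑ t ∈ S, w t * f t x ∂μ :=
    integral_congr_ae (Filter.Eventually.of_forall hinterp)
  rw [integral_finsetSum _ fun t _ => (hint t).const_mul _] at hone
  simp only [integral_const_mul] at hone
  rw [Finset.sum_congr rfl fun t ht => by
    rw [setIntegral_closedBall_comp_mul_det μ hv hR (hsmall t (hS t ht)).1 (hsmall t (hS t ht)).2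
      fun y => (M - ‖y - u‖ ^ 2) ^ m], ← Finset.sum_mul, hsum, one_mul] at hone
  simpa [f] using hone

end ChangeOfVariables


open MeasureTheory Metric Set in
/-- A `C¹` perturbation of the identity with compact support is onto, with no smallness assumption;
a form of Brouwer's fixed point theorem. -/
theorem surjective_id_add_of_hasCompactSupport {v : E → E} (hv : ContDiff ℝ 1 v)
    (hc : HasCompactSupport v) : Function.Surjective fun x => x + v x := by
  borelize E
  let μ : Measure E := Measure.addHaar
  intro u
  by_contra! hu
  obtain ⟨R, hR, hsub⟩ : ∃ R : ℝ, ‖u‖ < R ∧ tsupport v ⊆ closedBall 0 R := by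
    obtain ⟨r, hr⟩ := hc.isBounded.subset_closedBall 0
    exact ⟨max (‖u‖ + 1) r, lt_of_lt_of_le (lt_add_one _) (le_max_left _ _),
      hr.trans (closedBall_subset_closedBall (le_max_right _ _))⟩
  have hR0 : 0 < R := (norm_nonneg u).trans_lt hR
  have hvR : ∀ x ∉ closedBall (0 : E) R, v x = 0 := fun x hx =>
    image_eq_zero_of_notMem_tsupport fun h => hx (hsub h)
  have hvc := hv.continuous
  have hBc : IsCompact (closedBall (0 : E) R) := isCompact_closedBall 0 R
  -- `δ` is the distance from `u` to the image of the ball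
  obtain ⟨x₀, -, hx₀⟩ := hBc.exists_isMinOn ⟨0, by simp [hR0.le]⟩
    (f := fun x => ‖x + v x - u‖) (by fun_prop)
  set δ := ‖x₀ + v x₀ - u‖ with hδdef
  have hδ : 0 < δ := norm_pos_iff.2 (sub_ne_zero.2 (hu x₀))
  obtain ⟨M₁, hM₁⟩ := hBc.exists_bound_of_continuousOn (f := fun x => ‖x + v x - u‖ ^ 2)
    (by fun_prop)
  obtain ⟨M₂, hM₂⟩ := hBc.exists_bound_of_continuousOn (f := fun x => ‖x - u‖ ^ 2)
    (by fun_prop)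
  obtain ⟨D, hD⟩ := hBc.exists_bound_of_continuousOn
    (f := fun x => (ContinuousLinearMap.id ℝ E + fderiv ℝ v x).det) (by
      have := hv.continuous_fderiv one_ne_zero
      exact ((ContinuousLinearMap.continuous_det (𝕜 := ℝ) (E := E)).comp
        (f := fun x => ContinuousLinearMap.id ℝ E + fderiv ℝ v x) (by fun_prop)).continuousOn)
  simp only [norm_pow, norm_norm] at hM₁ hM₂
  set M := max (max M₁ M₂) (δ ^ 2)
  have hMδ : δ ^ 2 ≤ M := le_max_right _ _
  -- `M - ‖y - u‖ ^ 2` is at most `a = M - δ ^ 2` on the image of the ball, and at least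
  -- `b = M - r ^ 2 > a` on the ball of radius `r` about `u`
  obtain ⟨r, hr0, hr⟩ : ∃ r : ℝ, 0 < r ∧ r < min δ (R - ‖u‖) :=
    exists_between (lt_min hδ (sub_pos.2 hR))
  have hrδ : r < δ := hr.trans_le (min_le_left _ _)
  have hrsq : r ^ 2 < δ ^ 2 := by gcongr
  have hrB : ball u r ⊆ closedBall 0 R := fun x hx => by
    have h1 := norm_le_norm_add_norm_sub' x u
    have h2 : ‖x - u‖ < r := by simpa [dist_eq_norm] using hx
    have h3 := hr.trans_le (min_le_right _ _)
    simp only [mem_closedBall, dist_zero_right]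
    linarith
  set a := M - δ ^ 2
  set b := M - r ^ 2
  have ha0 : 0 ≤ a := sub_nonneg.2 hMδ
  have hab : a < b := sub_lt_sub_left hrsq M
  have hb0 : 0 < b := ha0.trans_lt hab
  have hpos : 0 < μ.real (ball u r) :=
    ENNReal.toReal_pos (measure_ball_pos μ u hr0).ne' measure_ball_lt_top.ne
  have hbound (m : ℕ) : b ^ m * μ.real (ball u r) ≤ a ^ m * D * μ.real (closedBall 0 R) := by
    have hint : IntegrableOn (fun x => (M - ‖x - u‖ ^ 2) ^ m) (closedBall 0 R) μ :=
      ContinuousOn.integrableOn_compact hBc (by fun_prop)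
    calc b ^ m * μ.real (ball u r) = ∫ x in ball u r, b ^ m ∂μ := by
          rw [setIntegral_const, smul_eq_mul, mul_comm]
      _ ≤ ∫ x in ball u r, (M - ‖x - u‖ ^ 2) ^ m ∂μ := by
          refine setIntegral_mono_on (integrableOn_const measure_ball_lt_top.ne)
            (hint.mono_set hrB) measurableSet_ball fun x hx => ?_
          have h2 : ‖x - u‖ < r := by simpa [dist_eq_norm] using hx
          gcongr
          exact sub_le_sub_left (by gcongr) M
      _ ≤ ∫ x in closedBall 0 R, (M - ‖x - u‖ ^ 2) ^ m ∂μ := by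
          refine setIntegral_mono_set hint ?_ hrB.eventuallyLE
          refine (ae_restrict_iff' measurableSet_closedBall).2 (.of_forall fun x hx => ?_)
          have : ‖x - u‖ ^ 2 ≤ M := (hM₂ x hx).trans ((le_max_right _ _).trans (le_max_left _ _))
          exact pow_nonneg (sub_nonneg.2 this) m
      _ = ∫ x in closedBall 0 R, (M - ‖x + v x - u‖ ^ 2) ^ m *
            (ContinuousLinearMap.id ℝ E + fderiv ℝ v x).det ∂μ :=
          (setIntegral_pow_comp_mul_det_eq μ hv hc hvR u M m).symm
      _ ≤ ‖∫ x in closedBall 0 R, (M - ‖x + v x - u‖ ^ 2) ^ m *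
            (ContinuousLinearMap.id ℝ E + fderiv ℝ v x).det ∂μ‖ := Real.le_norm_self _
      _ ≤ a ^ m * D * μ.real (closedBall 0 R) := by
          refine norm_setIntegral_le_of_norm_le_const measure_closedBall_lt_top fun x hx => ?_
          have h1 : ‖x + v x - u‖ ^ 2 ≤ M :=
            (hM₁ x hx).trans ((le_max_left _ _).trans (le_max_left _ _))
          have h2 : δ ≤ ‖x + v x - u‖ := hx₀ hx
          rw [norm_mul, norm_pow, Real.norm_of_nonneg (sub_nonneg.2 h1)]
          gcongr
          · exact sub_le_sub_left (by gcongr) M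
          · exact hD x hx
  have hlim : Filter.Tendsto (fun m : ℕ => (a / b) ^ m * (D * μ.real (closedBall 0 R)))
      Filter.atTop (nhds (0 * (D * μ.real (closedBall 0 R)))) :=
    (tendsto_pow_atTop_nhds_zero_of_lt_one (by positivity) ((div_lt_one hb0).2 hab)).mul_const _
  rw [zero_mul] at hlim
  refine hpos.not_ge (ge_of_tendsto' hlim fun m => ?_)
  rw [div_pow, div_mul_eq_mul_div, le_div_iff₀ (by positivity)]
  linarith [hbound m]

open Metric in
/-- If `⟪f x, x⟫ ≤ 0` everywhere, then `x = u + f x` is solvable for every `u`: a solution of the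
equation with `f` cut off outside the ball of radius `‖u‖ + 1` has norm at most `‖u‖`. -/
theorem exists_eq_add_of_inner_self_nonpos {f : E → E} (hf : ContDiff ℝ 1 f)
    (hinner : ∀ x, inner ℝ (f x) x ≤ 0) (u : E) : ∃ x, x = u + f x := by
  let φ : ContDiffBump (0 : E) := ⟨‖u‖ + 1, ‖u‖ + 2, by positivity, by linarith⟩
  obtain ⟨x, hx⟩ := surjective_id_add_of_hasCompactSupport (v := fun x => -(φ x • f x))
    (by
      have : ContDiff ℝ 1 φ := φ.contDiff
      exact (this.smul hf).neg) ((φ.hasCompactSupport.smul_right (f' := f)).neg) u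
  simp only at hx
  have hx' : x = u + φ x • f x := by rw [← hx]; abel
  refine ⟨x, ?_⟩
  have hnorm : ‖x‖ ≤ ‖u‖ := by
    have h1 : inner ℝ x x ≤ inner ℝ u x := by
      conv_lhs => enter [2]; rw [hx']
      rw [inner_add_left, inner_smul_left]
      have := mul_nonpos_of_nonneg_of_nonpos (φ.nonneg (x := x)) (hinner x)
      simpa using this
    rw [real_inner_self_eq_norm_sq] at h1
    have h2 := real_inner_le_norm u x
    by_contra! h
    nlinarith [norm_nonneg u]
  have hone : φ x = 1 := φ.one_of_mem_closedBall (by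
    simp only [mem_closedBall, dist_zero_right]
    exact hnorm.trans (by simp [φ]))
  rwa [hone, one_smul] at hx'

end

/-! ### Trigonometric polynomials in Fourier coefficients -/

noncomputable section

namespace FracNLS

open MeasureTheory

instance fact_two_pi_pos : Fact (0 < 2 * π) := ⟨Real.two_pi_pos⟩

/-- The trigonometric polynomial `∑_{|k| ≤ N} c_k e^{ikx}` with given coefficients. The coefficient
space carries the Euclidean norm, used below as a *real* inner product space. -/
def ofCoeffs (N : ℕ) (c : EuclideanSpace ℂ (Finset.Icc (-(N : ℤ)) (N : ℤ))) :
    C(AddCircle (2 * π), ℂ) :=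
  ∑ k : Finset.Icc (-(N : ℤ)) (N : ℤ), c k • fourier (k : ℤ)

/-- Each Fourier coefficient is a continuous linear functional for the uniform norm. -/
theorem exists_clm_eq_coeff (k : ℤ) :
    ∃ L : C(AddCircle (2 * π), ℂ) →L[ℂ] ℂ, ∀ v, L v = coeff v k := by
  refine ⟨(innerSL ℂ (fourierLp 2 k)).comp
    (ContinuousMap.toLp (E := ℂ) 2 AddCircle.haarAddCircle ℂ), fun v => ?_⟩
  rw [coeff, ← fourierCoeff_toLp, ← fourierBasis_repr, HilbertBasis.repr_apply_apply,
    coe_fourierBasis]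
  rfl

theorem coeff_fourier (k l : ℤ) :
    coeff (fourier k : C(AddCircle (2 * π), ℂ)) l = if l = k then 1 else 0 := by
  rw [coeff, fourierCoeff_fourier, Pi.single_apply]

theorem sum_coeff_smul_fourier {N : ℕ} (u : trigPoly N) :
    ∑ k ∈ Finset.Icc (-(N : ℤ)) (N : ℤ), coeff u.1 k • (fourier k : C(AddCircle (2 * π), ℂ))
      = u.1 := by
  choose L hL using exists_clm_eq_coeff
  obtain ⟨u, hu⟩ := u
  simp only [← hL]
  induction hu using Submodule.span_induction with
  | mem x hx =>
    obtain ⟨k, hk, rfl⟩ := hx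
    have hk' : k ∈ Finset.Icc (-(N : ℤ)) (N : ℤ) := Finset.mem_Icc.2 hk
    simp only [hL, coeff_fourier, ite_smul, one_smul, zero_smul, Finset.sum_ite_eq', hk', if_true]
  | zero => simp
  | add x y _ _ hx hy => simp only [map_add, add_smul, Finset.sum_add_distrib, hx, hy]
  | smul a x _ hx =>
    simp only [map_smul, smul_eq_mul, mul_smul, ← Finset.smul_sum, hx]

theorem coeff_ofCoeffs {N : ℕ} (c : EuclideanSpace ℂ (Finset.Icc (-(N : ℤ)) (N : ℤ)))
    (k : Finset.Icc (-(N : ℤ)) (N : ℤ)) : coeff (ofCoeffs N c) k = c k := by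
  obtain ⟨L, hL⟩ := exists_clm_eq_coeff k
  rw [← hL, ofCoeffs, map_sum]
  simp only [map_smul]
  simp only [hL, coeff_fourier, Subtype.coe_inj, smul_eq_mul, mul_ite, mul_one, mul_zero,
    Finset.sum_ite_eq, Finset.mem_univ, if_true]

/-- Parseval's identity for a trigonometric polynomial and a continuous function. -/
theorem sum_star_mul_coeff {N : ℕ} (c : EuclideanSpace ℂ (Finset.Icc (-(N : ℤ)) (N : ℤ)))
    (g : C(AddCircle (2 * π), ℂ)) :
    ∑ k : Finset.Icc (-(N : ℤ)) (N : ℤ), star (c k) * coeff g k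
      = ∫ x, star (ofCoeffs N c x) * g x ∂AddCircle.haarAddCircle := by
  simp only [coeff, fourierCoeff, ← integral_const_mul]
  rw [← integral_finsetSum]
  · refine integral_congr_ae (.of_forall fun x => ?_)
    simp only [ofCoeffs, ContinuousMap.coe_sum, Finset.sum_apply, ContinuousMap.smul_apply,
      star_sum, Finset.sum_mul, smul_eq_mul, star_mul', fourier_neg, mul_assoc]
    rfl
  · intro k _
    exact Continuous.integrable_of_hasCompactSupport (by fun_prop) (HasCompactSupport.of_compactSpace _)

/-- Mass conservation of the nonlinearity: `⟨P_N(|u|² u), u⟩ = ∫ |u|⁴` is real. -/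
theorem im_sum_star_mul_coeff_cubic {N : ℕ}
    (c : EuclideanSpace ℂ (Finset.Icc (-(N : ℤ)) (N : ℤ))) :
    (∑ k : Finset.Icc (-(N : ℤ)) (N : ℤ),
      star (c k) * coeff (fun x => cubic (ofCoeffs N c x)) k).im = 0 := by
  have hcub : Continuous fun x => cubic (ofCoeffs N c x) := by unfold cubic; fun_prop
  have key := sum_star_mul_coeff c ⟨_, hcub⟩
  simp only [ContinuousMap.coe_mk] at key
  rw [key]
  have (x : AddCircle (2 * π)) : star (ofCoeffs N c x) * cubic (ofCoeffs N c x)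
      = ((‖ofCoeffs N c x‖ ^ 4 : ℝ) : ℂ) := by
    rw [cubic, mul_left_comm, Complex.star_def, Complex.conj_mul']
    push_cast
    ring
  simp only [this]
  rw [integral_complex_ofReal]
  exact Complex.ofReal_im _

theorem contDiff_coeff_cubic (N : ℕ) (k : ℤ) :
    ContDiff ℝ 1 fun c : EuclideanSpace ℂ (Finset.Icc (-(N : ℤ)) (N : ℤ)) =>
      coeff (fun x => cubic (ofCoeffs N c x)) k := by
  obtain ⟨L, hL⟩ := exists_clm_eq_coeff k
  -- as a map into the Banach algebra of continuous functions, `u ↦ |u|² u = u * star u * u` is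
  -- visibly smooth over `ℝ` (it is not holomorphic)
  have heq (c : EuclideanSpace ℂ (Finset.Icc (-(N : ℤ)) (N : ℤ))) :
      coeff (fun x => cubic (ofCoeffs N c x)) k
        = L (ofCoeffs N c * star (ofCoeffs N c) * ofCoeffs N c) := by
    rw [hL]
    congr 1
    funext x
    simp [cubic, Complex.mul_conj']
  simp only [heq]
  have h1 : ContDiff ℝ 1 (ofCoeffs N) := by
    unfold ofCoeffs
    refine ContDiff.sum fun k _ => ?_
    have : ContDiff ℝ 1 fun c : EuclideanSpace ℂ (Finset.Icc (-(N : ℤ)) (N : ℤ)) => c k :=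
      contDiff_piLp_apply 2
    exact this.smul contDiff_const
  have h2 : ContDiff ℝ 1 fun c => star (ofCoeffs N c) :=
    (starL' ℝ : C(AddCircle (2 * π), ℂ) ≃L[ℝ] _).contDiff.comp h1
  exact (L.restrictScalars ℝ).contDiff.comp ((h1.mul h2).mul h1)

/-! ### Solvability of one stage -/

/-- The equation for the midpoint `Z` of a stage is solvable. -/
theorem exists_eq_add_smul_vecField (N : ℕ) (s τ : ℝ) (U : trigPoly N) :
    ∃ Z : trigPoly N, Z = U + (τ : ℂ) • vecField N s Z := by
  -- `τ F` read in Fourier coefficients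
  let f (c : EuclideanSpace ℂ (Finset.Icc (-(N : ℤ)) (N : ℤ))) :
      EuclideanSpace ℂ (Finset.Icc (-(N : ℤ)) (N : ℤ)) :=
    WithLp.toLp 2 fun k => (τ : ℂ) * (-(Complex.I * (((|((k : ℤ) : ℝ)| ^ (2 * s) : ℝ) : ℂ) * c k))
      + Complex.I * coeff (fun x => cubic (ofCoeffs N c x)) k)
  have hf : ContDiff ℝ 1 f := by
    rw [contDiff_piLp]
    intro k
    have h1 : ContDiff ℝ 1 fun c : EuclideanSpace ℂ (Finset.Icc (-(N : ℤ)) (N : ℤ)) => c k :=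
      contDiff_piLp_apply 2
    have h2 := contDiff_coeff_cubic N k
    exact contDiff_const.mul
      ((contDiff_const.mul (contDiff_const.mul h1)).neg.add (contDiff_const.mul h2))
  have hinner (c) : inner ℝ (f c) c = 0 := by
    have key := im_sum_star_mul_coeff_cubic c
    rw [Complex.im_sum] at key
    rw [PiLp.inner_apply]
    calc _ = ∑ k : Finset.Icc (-(N : ℤ)) (N : ℤ),
        -τ * (star (c k) * coeff (fun x => cubic (ofCoeffs N c x)) k).im := by
          refine Finset.sum_congr rfl fun k _ => ?_
          simp [f, Complex.inner]
          ring
      _ = 0 := by rw [← Finset.mul_sum, key, mul_zero]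
  obtain ⟨c, hc⟩ := exists_eq_add_of_inner_self_nonpos hf (fun c => (hinner c).le)
    (WithLp.toLp 2 fun k => coeff U.1 k)
  have hZ : ofCoeffs N c ∈ trigPoly N :=
    Submodule.sum_mem _ fun k _ => Submodule.smul_mem _ _
      (Submodule.subset_span ⟨k, Finset.mem_Icc.mp k.2, rfl⟩)
  refine ⟨⟨ofCoeffs N c, hZ⟩, Subtype.ext ?_⟩
  change ofCoeffs N c = U.1 + (τ : ℂ) •
    (-(Complex.I • ∑ k ∈ Finset.Icc (-(N : ℤ)) (N : ℤ),
        (((|(k : ℝ)| ^ (2 * s) : ℝ) : ℂ) * coeff (ofCoeffs N c) k) • fourier k)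
      + Complex.I • ∑ k ∈ Finset.Icc (-(N : ℤ)) (N : ℤ),
        coeff (fun x => cubic (ofCoeffs N c x)) k • fourier k)
  rw [← sum_coeff_smul_fourier U]
  simp only [← Finset.sum_coe_sort (Finset.Icc (-(N : ℤ)) (N : ℤ)), coeff_ofCoeffs,
    Finset.smul_sum, ← Finset.sum_neg_distrib, ← Finset.sum_add_distrib]
  conv_lhs => rw [ofCoeffs]
  refine Finset.sum_congr rfl fun k _ => ?_
  have hck : c k = coeff U.1 k + (f c) k := congrArg (fun d => d k) hc
  conv_lhs => rw [hck]
  simp only [f]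
  module

theorem exists_midpoint_step (N : ℕ) (s h : ℝ) (U : trigPoly N) :
    ∃ V : trigPoly N, V = U + (h : ℂ) • vecField N s ((1 / 2 : ℂ) • (V + U)) := by
  -- the new stage is recovered from the midpoint `Z` as `2 Z - U`
  obtain ⟨Z, hZ⟩ := exists_eq_add_smul_vecField N s (h / 2) U
  refine ⟨(2 : ℂ) • Z - U, ?_⟩
  have hmid : (1 / 2 : ℂ) • ((2 : ℂ) • Z - U + U) = Z := by module
  rw [hmid]
  conv_lhs => rw [hZ]
  push_cast
  module

end FracNLS

end

theorem proposition3p1 (N : ℕ) (hN : 1 ≤ N) (s : ℝ) (hs0 : 0 < s) (hs1 : s ≤ 1)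
    (q : ℕ) (b : Fin q → ℝ) (k : ℝ) (hk : 0 < k) (U : FracNLS.trigPoly N) :
    ∃ (Y : Fin (q + 1) → FracNLS.trigPoly N) (Unext : FracNLS.trigPoly N),
      FracNLS.IsSchemeStep N s k b U Y Unext := by
  choose V hV using fun h U => FracNLS.exists_midpoint_step N s h U
  let Y : Fin (q + 1) → FracNLS.trigPoly N := Fin.induction U fun j y => V (k * b j) y
  exact ⟨Y, Y (Fin.last q), rfl, fun j => hV (k * b j) (Y j.castSucc), rfl⟩
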